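/- All graphs are finite, simple and undirected; isolated nodes (and disconnected graphs) are allowed. The WL test is one-dimensional colour refinement with uniform initial colours: $c_0$ is constant on all nodes of all graphs, and $c_{t+1}(x)$ is the pair consisting of $c_t(x)$ and the multiset $\{\{c_t(y) : y \text{ adjacent to } x\}\}$. The WL test distinguishes $G$ and $H$ if for some $t$ the multisets $\{\{c_t(x) : x\in V(G)\}\}$ and $\{\{c_t(y) : y\in V(H)\}\}$ differ. For a collection $\mathcal G$ of graphs, a stable WL coloring of $\mathcal G$ is a map $\mathcal C:\bigcup_{G\in\mathcal G}V(G)\to\chi$ such that $\mathcal C(x)=\mathcal C(y)$ if and only if $c_t(x)=c_t(y)$ for all $t\ge 0$. Let $E^{\mathcal C}(G)=\{\{\,\{\{\mathcal C(x),\mathcal C(y)\}\} : \{x,y\}\in E(G)\,\}\}$ be the multiset of colored edges. An edge filtration of $\mathcal G$ with respect to $\mathcal C$ is a function $ef^{\mathcal C}:\bigcup_{G\in\mathcal G}E^{\mathcal C}(G)\to\mathbb R_{>0}$ with finite supremum. Given $G\in\mathcal G$, put $M(x,x)=0$, $M(x,y)=ef^{\mathcal C}(\{\{\mathcal C(x),\mathcal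 C(y)\}\})$ if $x\ne y$ are adjacent in $G$, and $M(x,y)=\infty$ otherwise. For $\varepsilon\in\mathbb R$ let $\mathrm{VR}_1^\varepsilon$ be the $1$-skeleton of the Vietoris–Rips complex on $V(G)$, whose simplices are the non-empty sets $s\subseteq V(G)$ with $M(x,y)\le\varepsilon$ for all $x,y\in s$. Let $\mathrm{ph}^i_{\mathrm{VR}}(G,ef^{\mathcal C})$ be the $i$-th persistence diagram (the multiset of off-diagonal birth–death pairs $(b,d)$, $b<d\le\infty$, of simplicial homology with $\mathbb Z/2$ coefficients) of the filtration $(\mathrm{VR}_1^\varepsilon)_{\varepsilon\in\mathbb R}$. If $ef^{\mathcal C}$ is injective, the topological edge diagram is $\mathrm{TED}(G,ef^{\mathcal C})=(\mathrm{ph}^0_{\mathrm{VR}}(G,ef^{\mathcal C}),\mathrm{ph}^1_{\mathrm{VR}}(G,ef^{\mathcal C}))$. **Theorem.** 1. Let $\mathcal G$ be a collection of graphs, $\mathcal C$ a stable WL coloring of $\mathcal G$ and $ef^{\mathcal C}$ an injective edge filtration of $\mathcal G$ with respect to $\mathcal C$. If $G,H\in\mathcal G$ are distinguished by the WL test, then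 $\mathrm{TED}(G,ef^{\mathcal C})\ne\mathrm{TED}(H,ef^{\mathcal C})$. 2. There are non-isomorphic graphs $G$ and $H$ that the WL test does not distinguish, such that for every collection $\mathcal G$ containing $G$ and $H$, every stable WL coloring $\mathcal C$ of $\mathcal G$ and every injective edge filtration $ef^{\mathcal C}$ of $\mathcal G$ with respect to $\mathcal C$, $\mathrm{TED}(G,ef^{\mathcal C})\ne\mathrm{TED}(H,ef^{\mathcal C})$. -/

import Mathlib

universe u v

/-! ### Weisfeiler–Lehman colour refinement -/

/-- Colours available after `t` rounds of colour refinement: initially a single colour; afterwards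
a colour is the pair (old colour, multiset of old colours of the neighbours), that is, the hash
function of the test is the (injective) pairing itself. -/
def WLColor : ℕ → Type
  | 0 => Unit
  | t + 1 => WLColor t × Multiset (WLColor t)

open Classical in
/-- The colour of a node after `t` rounds of the (one-dimensional) Weisfeiler–Lehman test started
from the uniform colouring. -/
noncomputable def wlColor {V : Type u} [Fintype V] (G : SimpleGraph V) : (t : ℕ) → V → WLColor t
  | 0, _ => ()
  | t + 1, x =>
      (wlColor G t x, (Finset.univ.filter fun y => G.Adj x y).val.map (wlColor G t))

/-- A finite simple graph. -/
structure FinGraph : Type (u + 1) where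
  V : Type u
  [fintypeV : Fintype V]
  graph : SimpleGraph V

attribute [instance] FinGraph.fintypeV

/-- The histogram (multiset) of node colours after `t` rounds. -/
noncomputable def wlHistogram (G : FinGraph.{u}) (t : ℕ) : Multiset (WLColor t) :=
  Finset.univ.val.map (wlColor G.graph t)

/-- The WL test distinguishes `G` and `H`: after some round the colour histograms differ. -/
def WLDistinguishes (G H : FinGraph.{u}) : Prop :=
  ∃ t : ℕ, wlHistogram G t ≠ wlHistogram H t

/-- `C` is a stable WL colouring (with uniform initial colours) of the nodes of all graphs in `𝒢`:
two nodes get the same colour exactly when no round of colour refinement separates them. The names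
of the colours are arbitrary. (Colours at nodes of graphs outside `𝒢` are irrelevant.) -/
def IsStableWLColoring (𝒢 : Set FinGraph.{u}) {χ : Type v} (C : (G : FinGraph.{u}) → G.V → χ) :
    Prop :=
  ∀ G ∈ 𝒢, ∀ H ∈ 𝒢, ∀ (x : G.V) (y : H.V),
    C G x = C H y ↔ ∀ t : ℕ, wlColor G.graph t x = wlColor H.graph t y

/-! ### Edge filtrations -/

/-- The set of all coloured edges `{{C x, C y}}`, `{x, y}` an edge of a graph in `𝒢`. -/
def coloredEdges (𝒢 : Set FinGraph.{u}) {χ : Type v} (C : (G : FinGraph.{u}) → G.V → χ) :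
    Set (Sym2 χ) :=
  ⋃ G ∈ 𝒢, Sym2.map (C G) '' G.graph.edgeSet

/-- `ef` is an edge filtration of `𝒢` with respect to `C`: a positive real-valued function on the
set of coloured edges, with finite supremum. (Values elsewhere are irrelevant.) -/
structure IsEdgeFiltration (𝒢 : Set FinGraph.{u}) {χ : Type v}
    (C : (G : FinGraph.{u}) → G.V → χ) (ef : Sym2 χ → ℝ) : Prop where
  pos : ∀ e ∈ coloredEdges 𝒢 C, 0 < ef e
  bddAbove : BddAbove (ef '' coloredEdges 𝒢 C)

open Classical in
/-- The distance matrix of a coloured graph: zero on the diagonal, the value of the edge filtration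
on edges, and infinity at all other pairs. -/
noncomputable def edgeDist {V : Type u} (G : SimpleGraph V) {χ : Type v} (c : V → χ)
    (ef : Sym2 χ → ℝ) (x y : V) : WithTop ℝ :=
  if x = y then 0 else if G.Adj x y then (ef s(c x, c y) : WithTop ℝ) else ⊤

/-! ### Simplicial homology with coefficients in `ℤ/2` -/

/-- The field `ℤ/2` with two elements. (A type synonym of `ZMod 2`, so that every submodule and
quotient space over it carries a single module structure, instead of the competing ones that exist
over `ZMod n`.) -/
def 𝔽₂ : Type := ZMod 2

noncomputable instance : Field 𝔽₂ := inferInstanceAs (Field (ZMod 2))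

namespace PreAbstractSimplicialComplex

variable {V : Type u}

/-- The `k`-skeleton: all simplices of dimension at most `k`. -/
def skeleton (K : PreAbstractSimplicialComplex V) (k : ℕ) : PreAbstractSimplicialComplex V where
  faces := {s | s ∈ K.faces ∧ s.card ≤ k + 1}
  isRelLowerSet_faces := fun _ hs =>
    ⟨(K.isRelLowerSet_faces hs.1).1, fun _ ht hne =>
      ⟨(K.isRelLowerSet_faces hs.1).2 ht hne, (Finset.card_le_card ht).trans hs.2⟩⟩

/-- The `n`-chains of a complex `K` on a finite vertex set `V`: formal sums of `n`-simplices (faces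
with `n + 1` vertices) of `K` with coefficients in `𝔽₂`, inside the space `Finset V → 𝔽₂` of formal
sums of arbitrary finite subsets of `V`. -/
noncomputable def chains (K : PreAbstractSimplicialComplex V) (n : ℕ) :
    Submodule 𝔽₂ (Finset V → 𝔽₂) where
  carrier := {c | ∀ s, ¬ (s ∈ K.faces ∧ s.card = n + 1) → c s = 0}
  zero_mem' := fun _ _ => rfl
  add_mem' := fun hc hc' s hs => by simp [hc s hs, hc' s hs]
  smul_mem' := fun r _ hc s hs => by simp [hc s hs]

theorem chains_mono {K L : PreAbstractSimplicialComplex V} (h : K ≤ L) (n : ℕ) :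
    K.chains n ≤ L.chains n :=
  fun _ hc s hs => hc s fun hs' => hs ⟨h hs'.1, hs'.2⟩

open Classical in
/-- The boundary operator: a simplex of positive dimension is sent to the sum of the faces obtained
by omitting one vertex, and a vertex is sent to zero. -/
noncomputable def boundary (V : Type u) [Fintype V] : (Finset V → 𝔽₂) →ₗ[𝔽₂] (Finset V → 𝔽₂) :=
  Fintype.linearCombination 𝔽₂ fun s : Finset V =>
    if 2 ≤ s.card then ∑ x ∈ s, Pi.single (s.erase x) (1 : 𝔽₂) else 0

variable [Fintype V]

/-- The `n`-cycles of `K`. -/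
noncomputable def cycles (K : PreAbstractSimplicialComplex V) (n : ℕ) :
    Submodule 𝔽₂ (Finset V → 𝔽₂) :=
  K.chains n ⊓ LinearMap.ker (boundary V)

/-- The `n`-boundaries of `K`. -/
noncomputable def boundaries (K : PreAbstractSimplicialComplex V) (n : ℕ) :
    Submodule 𝔽₂ (Finset V → 𝔽₂) :=
  (K.chains (n + 1)).map (boundary V)

/-- The `n`-th homology of `K`: cycles modulo boundaries. -/
abbrev Homology (K : PreAbstractSimplicialComplex V) (n : ℕ) : Type u :=
  ↥(K.cycles n) ⧸ (K.boundaries n).submoduleOf (K.cycles n)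

theorem cycles_mono {K L : PreAbstractSimplicialComplex V} (h : K ≤ L) (n : ℕ) :
    K.cycles n ≤ L.cycles n :=
  inf_le_inf_right _ (chains_mono h n)

theorem boundaries_mono {K L : PreAbstractSimplicialComplex V} (h : K ≤ L) (n : ℕ) :
    K.boundaries n ≤ L.boundaries n :=
  Submodule.map_mono (chains_mono h (n + 1))

/-- The map in homology induced by the inclusion of a subcomplex. -/
noncomputable def homologyMap {K L : PreAbstractSimplicialComplex V} (h : K ≤ L) (n : ℕ) :
    K.Homology n →ₗ[𝔽₂] L.Homology n :=
  Submodule.mapQ _ _ (Submodule.inclusion (cycles_mono h n)) fun _ hz => boundaries_mono h n hz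

end PreAbstractSimplicialComplex

/-! ### Persistence diagrams of filtrations -/

/-- A filtration of simplicial complexes on the vertex set `V`, indexed by real scales. -/
abbrev Filt (V : Type u) : Type u := ℝ →o PreAbstractSimplicialComplex V

namespace Filt

variable {V : Type u} [Fintype V] (K : Filt V) (n : ℕ)

/-- The classes of the homology at time `b` that at time `t ≥ b` have become equal to a class
coming from a time before `b`. -/
noncomputable def deadBy {b t : ℝ} (h : b ≤ t) : Submodule 𝔽₂ ((K b).Homology n) :=
  (⨆ s : Set.Iio b, LinearMap.range (PreAbstractSimplicialComplex.homologyMap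
      (K.monotone (s.2.le.trans h)) n)).comap
    (PreAbstractSimplicialComplex.homologyMap (K.monotone h) n)

/-- The classes of the homology at time `b` that have become equal to an older class at some time
`t < d`; for `d = ⊤`, at some time. -/
noncomputable def deadBefore (b : ℝ) (d : WithTop ℝ) : Submodule 𝔽₂ ((K b).Homology n) :=
  ⨆ (t : ℝ) (h : b ≤ t) (_ : (t : WithTop ℝ) < d), K.deadBy n h

open Classical in
/-- The `n`-th persistence diagram, a multiset of points `(b, d)` given by its multiplicity
function. For `b < d < ∞` the multiplicity of `(b, d)` is the number of independent homology classes
born at time `b` and dying at time `d`; that of `(b, ∞)` is the number of independent classes born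
at time `b` that never die. There are no points with `d ≤ b`. -/
noncomputable def persistenceDiagram : ℝ × WithTop ℝ → ℕ
  | (b, (d : ℝ)) =>
      if h : b < d then
        Module.finrank 𝔽₂
          (↥(K.deadBy n h.le) ⧸ (K.deadBefore n b (d : WithTop ℝ)).submoduleOf (K.deadBy n h.le))
      else 0
  | (b, ⊤) => Module.finrank 𝔽₂ ((K b).Homology n ⧸ K.deadBefore n b ⊤)

end Filt

/-! ### The Vietoris–Rips filtration and the topological edge diagram -/

/-- The Vietoris–Rips complex of the points `V` with distance matrix `M` at scale `ε`. It is empty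
for `ε < 0` if `M` has zero diagonal. -/
def vrComplex {V : Type u} (M : V → V → WithTop ℝ) (ε : ℝ) : PreAbstractSimplicialComplex V where
  faces := {s | s.Nonempty ∧ ∀ x ∈ s, ∀ y ∈ s, M x y ≤ (ε : WithTop ℝ)}
  isRelLowerSet_faces := fun _ hs =>
    ⟨hs.1, fun _ ht hne => ⟨hne, fun x hx y hy => hs.2 x (ht hx) y (ht hy)⟩⟩

/-- The filtration by the `k`-skeleta of the Vietoris–Rips complexes. -/
def vrFiltration {V : Type u} (M : V → V → WithTop ℝ) (k : ℕ) : Filt V where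
  toFun ε := (vrComplex M ε).skeleton k
  monotone' := fun _ _ h _ hs =>
    ⟨⟨hs.1.1, fun x hx y hy => (hs.1.2 x hx y hy).trans (WithTop.coe_le_coe.2 h)⟩, hs.2⟩

/-- The `i`-th persistence diagram of the filtration by `1`-skeleta of the Vietoris–Rips complexes
of the coloured graph `G`. -/
noncomputable def phVR (i : ℕ) (G : FinGraph.{u}) {χ : Type v} (c : G.V → χ) (ef : Sym2 χ → ℝ) :
    ℝ × WithTop ℝ → ℕ :=
  (vrFiltration (edgeDist G.graph c ef) 1).persistenceDiagram i

/-- The topological edge diagram. -/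
noncomputable def TED (G : FinGraph.{u}) {χ : Type v} (c : G.V → χ) (ef : Sym2 χ → ℝ) :
    (ℝ × WithTop ℝ → ℕ) × (ℝ × WithTop ℝ → ℕ) :=
  (phVR 0 G c ef, phVR 1 G c ef)

/-! Distinguished graphs have different diagrams because the diagrams count coloured edges and
nodes. An edge entering the filtration at scale `d` either merges two components, which gives a
point `(0, d)` in dimension 0, or closes a cycle, which gives a point `(d, ∞)` in dimension 1: a
1-skeleton has no 2-simplices, so cycles never die. Hence the multiplicities of these two points add
up to the number of edges of value `d` (`vr_edge_count`, `card_pairs_eq`). As the filtration is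
injective, this is the number of edges with one given pair of colours.

All nodes are born at 0, so the diagram in dimension 0 also gives the number of nodes
(`card_eq_of_persistenceDiagram_eq`). A stable colour `a` determines the degree `D a`, and `D a`
times the number of nodes coloured `a` is the number of ordered edges starting in colour `a`. This
recovers the sizes of all colour classes of positive degree. Isolated nodes share a single colour,
whose class is what remains of the total (`Multiset.eq_of_count_mul_eq`). The stable histogram
determines the histogram of every round.

For strictness, the hexagon and two disjoint triangles are both 2-regular on six nodes, so the WL
test cannot separate them, while the multiplicity of `(0, ∞)` sees the number of components. -/

/-! ### Ranks of subspaces and quotients of a quotient space -/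

theorem Submodule.finrank_comap_mkQ {K E : Type*} [Field K] [AddCommGroup E] [Module K E]
    [FiniteDimensional K E] (N : Submodule K E) (W : Submodule K (E ⧸ N)) :
    Module.finrank K (W.comap N.mkQ) = Module.finrank K W + Module.finrank K N := by
  have h1 := Submodule.finrank_quotient_add_finrank N
  have h2 := Submodule.finrank_quotient_add_finrank W
  have h3 := Submodule.finrank_quotient_add_finrank (W.comap N.mkQ)
  have h4 : Module.finrank K ((E ⧸ N) ⧸ W) = Module.finrank K (E ⧸ W.comap N.mkQ) := by
    have hs : Function.Surjective (W.mkQ ∘ₗ N.mkQ) :=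
      W.mkQ_surjective.comp N.mkQ_surjective
    have e := LinearMap.quotKerEquivOfSurjective _ hs
    rw [← e.finrank_eq, LinearMap.ker_comp, Submodule.ker_mkQ]
  omega

theorem Submodule.finrank_submoduleOf {K E : Type*} [Field K] [AddCommGroup E] [Module K E]
    {A B : Submodule K E} (h : A ≤ B) :
    Module.finrank K (A.submoduleOf B) = Module.finrank K A :=
  (Submodule.submoduleOfEquivOfLe h).finrank_eq

theorem Submodule.finrank_quotient_quotient_add {K E : Type*} [Field K] [AddCommGroup E] [Module K E]
    [FiniteDimensional K E] (N : Submodule K E) (W : Submodule K (E ⧸ N)) :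
    Module.finrank K ((E ⧸ N) ⧸ W) + Module.finrank K (W.comap N.mkQ) = Module.finrank K E := by
  rw [Submodule.finrank_comap_mkQ, ← Submodule.finrank_quotient_add_finrank N,
    ← Submodule.finrank_quotient_add_finrank W, add_assoc]

theorem Submodule.finrank_quotient_submoduleOf_add {K E : Type*} [Field K] [AddCommGroup E]
    [Module K E] [FiniteDimensional K E] (N : Submodule K E) {A B : Submodule K (E ⧸ N)}
    (h : A ≤ B) :
    Module.finrank K (B ⧸ A.submoduleOf B) + Module.finrank K (A.comap N.mkQ) =
      Module.finrank K (B.comap N.mkQ) := by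
  rw [Submodule.finrank_comap_mkQ, Submodule.finrank_comap_mkQ, ← add_assoc,
    ← Submodule.finrank_submoduleOf h, Submodule.finrank_quotient_add_finrank]

/-! ### Ranks of chains, cycles and boundaries -/

namespace PreAbstractSimplicialComplex

variable {V : Type u}

variable [Fintype V]

open Classical in
theorem finrank_chains (K : PreAbstractSimplicialComplex V) (n : ℕ) :
    Module.finrank 𝔽₂ (K.chains n) = Nat.card {s : Finset V // s ∈ K.faces ∧ s.card = n + 1} := by
  let e : K.chains n ≃ₗ[𝔽₂] ({s : Finset V // s ∈ K.faces ∧ s.card = n + 1} → 𝔽₂) :=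
    { toFun := fun c s => c.1 s.1
      invFun := fun f => ⟨fun s => if h : s ∈ K.faces ∧ s.card = n + 1 then f ⟨s, h⟩ else 0,
        fun s hs => by simp only [hs, dite_false]⟩
      map_add' := fun _ _ => rfl
      map_smul' := fun _ _ => rfl
      left_inv := fun c => by
        ext s
        by_cases h : s ∈ K.faces ∧ s.card = n + 1
        · simp [h]
        · simp only [h, dite_false]; exact (c.2 s h).symm
      right_inv := fun f => by ext s; simp [s.2] }
  rw [e.finrank_eq, Module.finrank_fintype_fun_eq_card, Nat.card_eq_fintype_card]

theorem homologyMap_comp {K L M : PreAbstractSimplicialComplex V} (h : K ≤ L) (h' : L ≤ M) (n : ℕ) :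
    homologyMap h' n ∘ₗ homologyMap h n = homologyMap (h.trans h') n := by
  refine Submodule.linearMap_qext _ ?_
  ext z
  rfl

/-- Rank-nullity for the boundary operator restricted to the `(n + 1)`-chains. -/
theorem finrank_cycles_add_finrank_boundaries (K : PreAbstractSimplicialComplex V) (n : ℕ) :
    Module.finrank 𝔽₂ (K.cycles (n + 1)) + Module.finrank 𝔽₂ (K.boundaries n) =
      Module.finrank 𝔽₂ (K.chains (n + 1)) := by
  have h := LinearMap.finrank_range_add_finrank_ker ((boundary V).domRestrict (K.chains (n + 1)))
  rw [LinearMap.range_domRestrict, LinearMap.ker_domRestrict] at h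
  have h2 : Module.finrank 𝔽₂ (K.cycles (n + 1)) =
      Module.finrank 𝔽₂ ((LinearMap.ker (boundary V)).submoduleOf (K.chains (n + 1))) := by
    rw [← Submodule.finrank_submoduleOf (show K.cycles (n + 1) ≤ K.chains (n + 1) from inf_le_left)]
    have e : (K.cycles (n + 1)).submoduleOf (K.chains (n + 1)) =
        (LinearMap.ker (boundary V)).submoduleOf (K.chains (n + 1)) := by
      ext c
      exact and_iff_right c.2
    rw [e]
  rw [h2, add_comm]
  exact h

end PreAbstractSimplicialComplex

/-! ### Multiplicities of persistence points as differences of ranks -/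

namespace Filt

open PreAbstractSimplicialComplex

variable {V : Type u} [Fintype V] (K : Filt V) (n : ℕ)

/-- Lifts the computation from homology to chains. The scale `p` stands for all scales before `b`,
so the supremum of ranges is a single range; a cycle is then dead by `t` exactly when it is an older
cycle plus a boundary at `t`. -/
theorem comap_mkQ_deadBy {p b t : ℝ} (hpb : p < b) (hp : ∀ s < b, K s ≤ K p) (h : b ≤ t) :
    (K.deadBy n h).comap (Submodule.mkQ _) =
      ((K p).cycles n ⊔ (K t).boundaries n).submoduleOf ((K b).cycles n) := by
  have hsup : (⨆ s : Set.Iio b, LinearMap.range (homologyMap (K.monotone (s.2.le.trans h)) n)) =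
      LinearMap.range (homologyMap (K.monotone (hpb.le.trans h)) n) := by
    refine le_antisymm (iSup_le fun s => ?_)
      (le_iSup_of_le ⟨p, hpb⟩ le_rfl)
    rw [← homologyMap_comp (hp s s.2) (K.monotone (hpb.le.trans h))]
    exact LinearMap.range_comp_le_range _ _
  ext z
  rw [deadBy, hsup]
  simp only [Submodule.mem_comap, Submodule.submoduleOf, Submodule.mem_sup,
    Submodule.subtype_apply]
  constructor
  · rintro ⟨w, hw⟩
    obtain ⟨w, rfl⟩ := Submodule.mkQ_surjective _ w
    refine ⟨w, w.2, z - w, ?_, by abel⟩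
    exact (Submodule.Quotient.eq (((K t).boundaries n).submoduleOf ((K t).cycles n))).1 hw.symm
  · rintro ⟨w, hw, y, hy, e⟩
    refine ⟨Submodule.mkQ _ ⟨w, hw⟩, ?_⟩
    refine ((Submodule.Quotient.eq _).2 ?_).symm
    change (z : Finset V → 𝔽₂) - w ∈ (K t).boundaries n
    rw [← e, add_sub_cancel_left]
    exact hy

theorem deadBy_mono {p b t t' : ℝ} (hpb : p < b) (hp : ∀ s < b, K s ≤ K p) (h : b ≤ t)
    (h' : b ≤ t') (htt : K t ≤ K t') : K.deadBy n h ≤ K.deadBy n h' := by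
  rw [← Submodule.comap_le_comap_iff_of_surjective (Submodule.mkQ_surjective _),
    K.comap_mkQ_deadBy n hpb hp, K.comap_mkQ_deadBy n hpb hp]
  exact Submodule.comap_mono (sup_le_sup_left (boundaries_mono htt n) _)

theorem deadBefore_eq_deadBy {p b t : ℝ} (hpb : p < b) (hp : ∀ s < b, K s ≤ K p) (h : b ≤ t)
    {d : WithTop ℝ} (htd : (t : WithTop ℝ) < d) (ht : ∀ s : ℝ, (s : WithTop ℝ) < d → K s ≤ K t) :
    K.deadBefore n b d = K.deadBy n h := by
  refine le_antisymm (iSup_le fun s => iSup_le fun hs => iSup_le fun hsd => ?_) ?_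
  · exact K.deadBy_mono n hpb hp hs h (ht s hsd)
  · exact le_iSup_of_le t (le_iSup_of_le h (le_iSup_of_le htd le_rfl))

/-- The multiplicity of an essential point. -/
theorem persistenceDiagram_top {p b T : ℝ} (hpb : p < b) (hp : ∀ s < b, K s ≤ K p) (hT : b ≤ T)
    (hKT : ∀ s, K s ≤ K T) (hB : (K T).boundaries n ≤ (K b).cycles n) :
    K.persistenceDiagram n (b, ⊤) +
        Module.finrank 𝔽₂ ((K p).cycles n ⊔ (K T).boundaries n : Submodule 𝔽₂ (Finset V → 𝔽₂)) =
      Module.finrank 𝔽₂ ((K b).cycles n) := by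
  change Module.finrank 𝔽₂ ((K b).Homology n ⧸ K.deadBefore n b ⊤) + _ = _
  rw [K.deadBefore_eq_deadBy n hpb hp hT (WithTop.coe_lt_top T) fun s _ => hKT s]
  -- By `hB` the sum of older cycles and boundaries lies inside the cycles at `b`, so `submoduleOf`
  -- does not lower its rank.
  have h1 := Submodule.finrank_quotient_quotient_add _ (K.deadBy n hT)
  rwa [K.comap_mkQ_deadBy n hpb hp,
    Submodule.finrank_submoduleOf (sup_le (cycles_mono (K.monotone hpb.le) n) hB)] at h1

/-- The multiplicity of a finite point. -/
theorem persistenceDiagram_coe {p b q d : ℝ} (hpb : p < b) (hp : ∀ s < b, K s ≤ K p) (hbq : b ≤ q)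
    (hqd : q < d) (hq : ∀ s < d, K s ≤ K q) (hB : (K d).boundaries n ≤ (K b).cycles n) :
    K.persistenceDiagram n (b, (d : WithTop ℝ)) +
        Module.finrank 𝔽₂ ((K p).cycles n ⊔ (K q).boundaries n : Submodule 𝔽₂ (Finset V → 𝔽₂)) =
      Module.finrank 𝔽₂
        ((K p).cycles n ⊔ (K d).boundaries n : Submodule 𝔽₂ (Finset V → 𝔽₂)) := by
  have hbd : b < d := hbq.trans_lt hqd
  have key : K.persistenceDiagram n (b, (d : WithTop ℝ)) = Module.finrank 𝔽₂
      (↥(K.deadBy n hbd.le) ⧸ (K.deadBy n hbq).submoduleOf (K.deadBy n hbd.le)) := by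
    rw [← K.deadBefore_eq_deadBy n hpb hp hbq (WithTop.coe_lt_coe.2 hqd)
      fun s hs => hq s (WithTop.coe_lt_coe.1 hs)]
    exact dif_pos hbd
  have hZ := cycles_mono (K.monotone hpb.le) n
  have h1 := Submodule.finrank_quotient_submoduleOf_add _
    (K.deadBy_mono n hpb hp hbq hbd.le (K.monotone hqd.le))
  rwa [K.comap_mkQ_deadBy n hpb hp, K.comap_mkQ_deadBy n hpb hp,
    Submodule.finrank_submoduleOf (sup_le hZ hB), Submodule.finrank_submoduleOf
    (sup_le hZ ((boundaries_mono (K.monotone hqd.le) n).trans hB)), ← key] at h1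

end Filt

/-! ### Cycles and boundaries in dimension zero -/

namespace PreAbstractSimplicialComplex

variable {V : Type u}

theorem chains_eq_bot {K : PreAbstractSimplicialComplex V} {n : ℕ}
    (h : ∀ s ∈ K.faces, s.card ≠ n + 1) : K.chains n = ⊥ :=
  eq_bot_iff.2 fun _ hc => funext fun s => hc s fun hs => h s hs.1 hs.2

variable [Fintype V]

theorem cycles_zero (K : PreAbstractSimplicialComplex V) : K.cycles 0 = K.chains 0 := by
  refine inf_eq_left.2 fun c hc => ?_
  rw [LinearMap.mem_ker, boundary, Fintype.linearCombination_apply]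
  refine Finset.sum_eq_zero fun s _ => ?_
  by_cases hs : s.card = 1
  · simp [hs]
  · rw [hc s fun h => hs h.2, zero_smul]

theorem finrank_cycles_zero {K : PreAbstractSimplicialComplex V} (h : ∀ x, {x} ∈ K.faces) :
    Module.finrank 𝔽₂ (K.cycles 0) = Fintype.card V := by
  rw [cycles_zero, finrank_chains, ← Nat.card_eq_fintype_card]
  refine (Nat.card_congr (Equiv.ofBijective
    (fun x : V => ⟨{x}, h x, by simp⟩) ⟨fun x y h => ?_, ?_⟩)).symm
  · simpa using h
  · rintro ⟨s, hs, h1⟩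
    obtain ⟨y, rfl⟩ := Finset.card_eq_one.1 h1
    exact ⟨y, rfl⟩

open Classical in
theorem boundary_single_pair {x y : V} (h : x ≠ y) :
    boundary V (Pi.single {x, y} 1) = Pi.single {x} 1 + Pi.single {y} 1 := by
  have h2 : 2 ≤ ({x, y} : Finset V).card := by rw [Finset.card_pair h]
  have e1 : ({x, y} : Finset V).erase x = {y} := by
    ext z; simp only [Finset.mem_erase, Finset.mem_insert, Finset.mem_singleton]; grind
  have e2 : ({x, y} : Finset V).erase y = {x} := by
    ext z; simp only [Finset.mem_erase, Finset.mem_insert, Finset.mem_singleton]; grind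
  rw [boundary, Fintype.linearCombination_apply, Finset.sum_eq_single {x, y}]
  · rw [Pi.single_eq_same, one_smul, if_pos h2, Finset.sum_pair h]
    rw [e1, e2, add_comm]
  · intro s _ hs
    rw [Pi.single_eq_of_ne hs, zero_smul]
  · simp

/-- Only the vertices of `L` matter, so `K` may be a later stage of the filtration with more edges;
this supplies `hB` in dimension 0. -/
theorem boundaries_zero_le {K L : PreAbstractSimplicialComplex V} (h : ∀ x, {x} ∈ L.faces) :
    K.boundaries 0 ≤ L.cycles 0 := by
  rw [cycles_zero]
  rintro _ ⟨c, hc, rfl⟩ u hu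
  rw [boundary, Fintype.linearCombination_apply, Finset.sum_apply]
  classical
  refine Finset.sum_eq_zero fun s _ => ?_
  by_cases hs : s.card = 2
  · rw [if_pos hs.ge, Pi.smul_apply, Finset.sum_apply, Finset.sum_eq_zero, smul_zero]
    intro x hx
    refine Pi.single_eq_of_ne (fun hu' => ?_) _
    subst hu'
    have h1 : (s.erase x).card = 1 := by rw [Finset.card_erase_of_mem hx, hs]
    obtain ⟨y, hy⟩ := Finset.card_eq_one.1 h1
    exact hu ⟨hy ▸ h y, h1⟩
  · rw [hc s fun h => hs h.2, zero_smul]; rfl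

theorem boundaries_eq_bot {K : PreAbstractSimplicialComplex V} {n : ℕ}
    (h : ∀ s ∈ K.faces, s.card ≠ n + 2) : K.boundaries n = ⊥ := by
  rw [boundaries, chains_eq_bot h, Submodule.map_bot]

end PreAbstractSimplicialComplex

open PreAbstractSimplicialComplex Filt

/-! ### Reading edge and node counts off the Vietoris–Rips diagrams -/

section VietorisRips

variable {V : Type u} {M : V → V → WithTop ℝ}

theorem mem_vrFiltration {k : ℕ} {t : ℝ} {s : Finset V} : s ∈ (vrFiltration M k t).faces ↔
    (s.Nonempty ∧ ∀ x ∈ s, ∀ y ∈ s, M x y ≤ (t : WithTop ℝ)) ∧ s.card ≤ k + 1 := Iff.rfl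

theorem vrFiltration_le {k : ℕ} {s t : ℝ}
    (h : ∀ x y, M x y ≤ (s : WithTop ℝ) → M x y ≤ (t : WithTop ℝ)) :
    vrFiltration M k s ≤ vrFiltration M k t :=
  fun _ hs => ⟨⟨hs.1.1, fun x hx y hy => h x y (hs.1.2 x hx y hy)⟩, hs.2⟩

theorem singleton_mem_vrFiltration (h0 : ∀ x, M x x = 0) {k : ℕ} {t : ℝ} (ht : 0 ≤ t) (x : V) :
    {x} ∈ (vrFiltration M k t).faces := by
  rw [mem_vrFiltration]
  simp [h0, ht]

theorem vrFiltration_faces_eq_empty (h0 : ∀ x, M x x = 0) {k : ℕ} {t : ℝ} (ht : t < 0)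
    (s : Finset V) : s ∉ (vrFiltration M k t).faces := by
  rw [mem_vrFiltration]
  rintro ⟨⟨⟨x, hx⟩, h⟩, -⟩
  have := h x hx x hx
  rw [h0] at this
  exact absurd (WithTop.coe_le_coe.1 this) ht.not_ge

theorem vrFiltration_le_of_lt_zero (h0 : ∀ x, M x x = 0) {k : ℕ} {t : ℝ} (ht : t < 0)
    (K : PreAbstractSimplicialComplex V) : vrFiltration M k t ≤ K :=
  fun s hs => absurd hs (vrFiltration_faces_eq_empty h0 ht s)

/-- The complex changes only at finite values of `M`, so a bound for the values below `d` represents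
all scales below `d`. -/
theorem vrFiltration_le_of_greatest_lt {S : Finset ℝ} (hS : ∀ x y (r : ℝ), M x y = r → r ∈ S)
    {p d : ℝ} (hp : ∀ s ∈ S, s < d → s ≤ p) (k : ℕ) :
    ∀ s < d, vrFiltration M k s ≤ vrFiltration M k p := by
  refine fun s hs => vrFiltration_le fun x y h => ?_
  obtain ⟨r, hr⟩ := WithTop.ne_top_iff_exists.1 (ne_top_of_le_ne_top WithTop.coe_ne_top h)
  rw [← hr] at h ⊢
  exact WithTop.coe_le_coe.2 (hp r (hS x y r hr.symm) ((WithTop.coe_le_coe.1 h).trans_lt hs))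

theorem vrFiltration_le_of_forall_le {S : Finset ℝ} (hS : ∀ x y (r : ℝ), M x y = r → r ∈ S)
    {T : ℝ} (hT : ∀ s ∈ S, s ≤ T) (k : ℕ) (s : ℝ) : vrFiltration M k s ≤ vrFiltration M k T := by
  refine vrFiltration_le fun x y h => ?_
  obtain ⟨r, hr⟩ := WithTop.ne_top_iff_exists.1 (ne_top_of_le_ne_top WithTop.coe_ne_top h)
  rw [← hr]
  exact WithTop.coe_le_coe.2 (hT r (hS x y r hr.symm))

variable [Fintype V]

theorem boundaries_one_vrFiltration (t : ℝ) : (vrFiltration M 1 t).boundaries 1 = ⊥ :=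
  boundaries_eq_bot fun _ hs h => by have := hs.2; omega

theorem cycles_vrFiltration_of_lt_zero (h0 : ∀ x, M x x = 0) {k n : ℕ} {t : ℝ} (ht : t < 0) :
    (vrFiltration M k t).cycles n = ⊥ := by
  rw [cycles, chains_eq_bot, bot_inf_eq]
  exact fun s hs => absurd hs (vrFiltration_faces_eq_empty h0 ht s)

theorem vr_persistenceDiagram_zero_top (h0 : ∀ x, M x x = 0) {k : ℕ} {T : ℝ} (hT : 0 ≤ T)
    (hKT : ∀ s, vrFiltration M k s ≤ vrFiltration M k T) :
    (vrFiltration M k).persistenceDiagram 0 (0, ⊤) +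
      Module.finrank 𝔽₂ ((vrFiltration M k T).boundaries 0) = Fintype.card V := by
  -- Any negative scale serves as `p`: the complex is empty there, so no class is older than time 0.
  have h := persistenceDiagram_top (vrFiltration M k) 0 (p := -1) (by norm_num)
    (fun s hs => vrFiltration_le_of_lt_zero h0 hs _) hT hKT
    (boundaries_zero_le (singleton_mem_vrFiltration h0 le_rfl))
  rwa [cycles_vrFiltration_of_lt_zero h0 (by norm_num), bot_sup_eq,
    finrank_cycles_zero (singleton_mem_vrFiltration h0 le_rfl)] at h

theorem vr_persistenceDiagram_zero_coe (h0 : ∀ x, M x x = 0) {k : ℕ} {q d : ℝ} (hq : 0 ≤ q)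
    (hqd : q < d) (hK : ∀ s < d, vrFiltration M k s ≤ vrFiltration M k q) :
    (vrFiltration M k).persistenceDiagram 0 (0, (d : WithTop ℝ)) +
      Module.finrank 𝔽₂ ((vrFiltration M k q).boundaries 0) =
      Module.finrank 𝔽₂ ((vrFiltration M k d).boundaries 0) := by
  have h := persistenceDiagram_coe (vrFiltration M k) 0 (p := -1) (by norm_num)
    (fun s hs => vrFiltration_le_of_lt_zero h0 hs _) hq hqd hK
    (boundaries_zero_le (singleton_mem_vrFiltration h0 le_rfl))
  rwa [cycles_vrFiltration_of_lt_zero h0 (by norm_num), bot_sup_eq, bot_sup_eq] at h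

theorem vr_persistenceDiagram_one_top {p d T : ℝ} (hpd : p < d)
    (hK : ∀ s < d, vrFiltration M 1 s ≤ vrFiltration M 1 p) (hT : d ≤ T)
    (hKT : ∀ s, vrFiltration M 1 s ≤ vrFiltration M 1 T) :
    (vrFiltration M 1).persistenceDiagram 1 (d, ⊤) +
      Module.finrank 𝔽₂ ((vrFiltration M 1 p).cycles 1) =
      Module.finrank 𝔽₂ ((vrFiltration M 1 d).cycles 1) := by
  have h := persistenceDiagram_top (vrFiltration M 1) 1 hpd hK hT hKT
    (by rw [boundaries_one_vrFiltration]; exact bot_le)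
  rwa [boundaries_one_vrFiltration, sup_bot_eq] at h

/-- The number of edges entering at scale `d`: each of them kills a component or creates a cycle. -/
theorem vr_edge_count (h0 : ∀ x, M x x = 0) {p d T : ℝ} (hp : 0 ≤ p) (hpd : p < d)
    (hK : ∀ s < d, vrFiltration M 1 s ≤ vrFiltration M 1 p) (hT : d ≤ T)
    (hKT : ∀ s, vrFiltration M 1 s ≤ vrFiltration M 1 T) :
    (vrFiltration M 1).persistenceDiagram 0 (0, (d : WithTop ℝ)) +
      (vrFiltration M 1).persistenceDiagram 1 (d, ⊤) +
      Module.finrank 𝔽₂ ((vrFiltration M 1 p).chains 1) =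
      Module.finrank 𝔽₂ ((vrFiltration M 1 d).chains 1) := by
  -- Between `p` and `d`, the growth in rank of the 0-boundaries and that of the 1-cycles are the
  -- two multiplicities; by rank-nullity they sum to the growth of the 1-chains.
  have h1 := vr_persistenceDiagram_zero_coe h0 hp hpd hK
  have h2 := vr_persistenceDiagram_one_top hpd hK hT hKT
  have h3 : Module.finrank 𝔽₂ ((vrFiltration M 1 p).cycles 1) + _ =
      Module.finrank 𝔽₂ ((vrFiltration M 1 p).chains 1) := finrank_cycles_add_finrank_boundaries _ 0
  have h4 : Module.finrank 𝔽₂ ((vrFiltration M 1 d).cycles 1) + _ =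
      Module.finrank 𝔽₂ ((vrFiltration M 1 d).chains 1) := finrank_cycles_add_finrank_boundaries _ 0
  omega

open Classical in
-- The map sending an ordered pair to its underlying set is two-to-one onto the edges; the fibre
-- over an edge is its `offDiag`.
theorem two_mul_finrank_chains_one (h0 : ∀ x, M x x = 0) (hM : ∀ x y, M x y = M y x) {t : ℝ}
    (ht : 0 ≤ t) : 2 * Module.finrank 𝔽₂ ((vrFiltration M 1 t).chains 1) =
      (Finset.univ.filter fun q : V × V => q.1 ≠ q.2 ∧ M q.1 q.2 ≤ (t : WithTop ℝ)).card := by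
  have hmaps : ∀ q ∈ Finset.univ.filter fun q : V × V => q.1 ≠ q.2 ∧ M q.1 q.2 ≤ (t : WithTop ℝ),
      ({q.1, q.2} : Finset V) ∈ Finset.univ.filter fun s : Finset V =>
        s ∈ (vrFiltration M 1 t).faces ∧ s.card = 2 := by
    rintro ⟨x, y⟩ hq
    simp only [Finset.mem_filter, Finset.mem_univ, true_and] at hq ⊢
    have h00 : (0 : WithTop ℝ) ≤ t := WithTop.coe_le_coe.2 ht
    refine ⟨mem_vrFiltration.2 ⟨⟨by simp, ?_⟩, by rw [Finset.card_pair hq.1]⟩, Finset.card_pair hq.1⟩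
    have h3 := hM x y ▸ hq.2
    simp [h0, hq.2, h3, h00]
  rw [finrank_chains, Finset.card_eq_sum_card_fiberwise hmaps, Nat.card_eq_fintype_card,
    Fintype.card_subtype, mul_comm]
  refine (Finset.sum_const_nat fun s hs => ?_).symm
  simp only [Finset.mem_filter, Finset.mem_univ, true_and] at hs
  have e : (Finset.univ.filter fun q : V × V =>
      q.1 ≠ q.2 ∧ M q.1 q.2 ≤ (t : WithTop ℝ)).filter (fun q => ({q.1, q.2} : Finset V) = s) =
      s.offDiag := by
    ext ⟨x, y⟩
    simp only [Finset.mem_filter, Finset.mem_univ, true_and, Finset.mem_offDiag]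
    constructor
    · rintro ⟨⟨h, -⟩, rfl⟩
      simp [h]
    · rintro ⟨hx, hy, h⟩
      refine ⟨⟨h, hs.1.1.2 x hx y hy⟩, Finset.eq_of_subset_of_card_le ?_ ?_⟩
      · simp [Finset.insert_subset_iff, hx, hy]
      · rw [hs.2, Finset.card_pair h]
  rw [e, Finset.offDiag_card, hs.2]

theorem Finset.exists_greatest_lt {S : Finset ℝ} (h0 : 0 ∈ S) {d : ℝ} (hd : 0 < d) :
    ∃ p ∈ S, 0 ≤ p ∧ p < d ∧ ∀ s ∈ S, s < d → s ≤ p := by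
  have hne : (S.filter (· < d)).Nonempty := ⟨0, by simp [h0, hd]⟩
  have hm := Finset.max'_mem _ hne
  rw [Finset.mem_filter] at hm
  exact ⟨_, hm.1, Finset.le_max' _ _ (by simp [h0, hd]), hm.2,
    fun s hs hsd => Finset.le_max' _ _ (by simp [hs, hsd])⟩

theorem exists_finset_values (M : V → V → WithTop ℝ) :
    ∃ S : Finset ℝ, ∀ x y (r : ℝ), M x y = r → r ∈ S := by
  classical
  exact ⟨Finset.univ.image fun q : V × V => (M q.1 q.2).untopD 0, fun x y r h =>
    Finset.mem_image.2 ⟨(x, y), Finset.mem_univ _, by simp [h]⟩⟩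

open Classical in
/-- The number of ordered pairs at distance `d` is read off from the diagrams. -/
theorem card_pairs_eq (h0 : ∀ x, M x x = 0) (hM : ∀ x y, M x y = M y x) {d : ℝ} (hd : 0 < d) :
    (Finset.univ.filter fun q : V × V => M q.1 q.2 = (d : WithTop ℝ)).card =
      2 * ((vrFiltration M 1).persistenceDiagram 0 (0, (d : WithTop ℝ)) +
        (vrFiltration M 1).persistenceDiagram 1 (d, ⊤)) := by
  obtain ⟨S, hS⟩ := exists_finset_values M
  -- Adding 0 provides a non-negative predecessor of `d`; adding `d` makes the maximum a last scale
  -- beyond `d`, even if `d` is not a value of `M`.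
  have hS' : ∀ x y (r : ℝ), M x y = r → r ∈ insert 0 (insert d S) := fun x y r h => by
    simp [hS x y r h]
  have hne : (insert 0 (insert d S)).Nonempty := ⟨0, by simp⟩
  obtain ⟨p, -, hp0, hpd, hp⟩ :=
    Finset.exists_greatest_lt (Finset.mem_insert_self 0 (insert d S)) hd
  have h := vr_edge_count h0 hp0 hpd (vrFiltration_le_of_greatest_lt hS' hp 1)
    (Finset.le_max' _ d (by simp) : d ≤ (insert 0 (insert d S)).max' hne)
    (vrFiltration_le_of_forall_le hS' (fun s hs => Finset.le_max' _ s hs) 1)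
  have h1 := two_mul_finrank_chains_one h0 hM hp0
  have h2 := two_mul_finrank_chains_one h0 hM hd.le
  have h3 : (Finset.univ.filter fun q : V × V => q.1 ≠ q.2 ∧ M q.1 q.2 ≤ (d : WithTop ℝ)) =
      (Finset.univ.filter fun q : V × V => q.1 ≠ q.2 ∧ M q.1 q.2 ≤ (p : WithTop ℝ)) ∪
      (Finset.univ.filter fun q : V × V => M q.1 q.2 = (d : WithTop ℝ)) := by
    ext ⟨x, y⟩
    simp only [Finset.mem_filter, Finset.mem_univ, true_and, Finset.mem_union]
    constructor
    · rintro ⟨hxy, h⟩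
      rcases h.eq_or_lt with h | h
      · exact Or.inr h
      · obtain ⟨r, hr⟩ := WithTop.ne_top_iff_exists.1 h.ne_top
        rw [← hr] at h ⊢
        exact Or.inl ⟨hxy, WithTop.coe_le_coe.2
          (hp r (hS' x y r hr.symm) (WithTop.coe_lt_coe.1 h))⟩
    · rintro (⟨hxy, h⟩ | h)
      · exact ⟨hxy, h.trans (WithTop.coe_le_coe.2 hpd.le)⟩
      · refine ⟨?_, h.le⟩
        rintro rfl
        rw [h0] at h
        exact hd.ne (WithTop.coe_eq_coe.1 h)
  rw [h3, Finset.card_union_of_disjoint] at h2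
  · omega
  · rw [Finset.disjoint_left]
    rintro ⟨x, y⟩ ha hb
    simp only [Finset.mem_filter, Finset.mem_univ, true_and] at ha hb
    rw [hb] at ha
    exact hpd.not_ge (WithTop.coe_le_coe.1 ha.2)

theorem boundaries_vrFiltration_zero (hpos : ∀ x y, x ≠ y → 0 < M x y) (k : ℕ) :
    (vrFiltration M k 0).boundaries 0 = ⊥ := by
  classical
  refine boundaries_eq_bot fun s hs h2 => ?_
  obtain ⟨x, y, hxy, rfl⟩ := Finset.card_eq_two.1 h2
  exact (hpos x y hxy).not_ge (hs.1.2 x (by simp) y (by simp))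

/-- The number of vertices is determined by the diagram in dimension zero. -/
theorem card_eq_of_persistenceDiagram_eq {W : Type u} [Fintype W] {N : W → W → WithTop ℝ}
    (h0 : ∀ x, M x x = 0) (hpos : ∀ x y, x ≠ y → 0 < M x y)
    (h0' : ∀ x, N x x = 0) (hpos' : ∀ x y, x ≠ y → 0 < N x y) {k : ℕ}
    (h : (vrFiltration M k).persistenceDiagram 0 = (vrFiltration N k).persistenceDiagram 0) :
    Fintype.card V = Fintype.card W := by
  classical
  obtain ⟨S₁, hS₁⟩ := exists_finset_values M
  obtain ⟨S₂, hS₂⟩ := exists_finset_values N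
  obtain ⟨S, hS⟩ : ∃ S, S = insert 0 (S₁ ∪ S₂) := ⟨_, rfl⟩
  have hz : (0 : ℝ) ∈ S := by simp [hS]
  have hM : ∀ x y (r : ℝ), M x y = r → r ∈ S := fun x y r h => by simp [hS, hS₁ x y r h]
  have hN : ∀ x y (r : ℝ), N x y = r → r ∈ S := fun x y r h => by simp [hS, hS₂ x y r h]
  -- Induction along the common critical scales of both matrices: the rank of the 0-boundaries
  -- starts at zero and grows at `d` by the multiplicity of `(0, d)`.
  have key : ∀ n : ℕ, ∀ d ∈ S, 0 ≤ d → (S.filter (· < d)).card = n →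
      Module.finrank 𝔽₂ ((vrFiltration M k d).boundaries 0) =
      Module.finrank 𝔽₂ ((vrFiltration N k d).boundaries 0) := by
    intro n
    induction n using Nat.strong_induction_on with
    | _ n ih =>
      intro d hd hd0 hn
      rcases hd0.eq_or_lt with rfl | hd0
      · rw [boundaries_vrFiltration_zero hpos, boundaries_vrFiltration_zero hpos', finrank_bot,
          finrank_bot]
      · obtain ⟨p, hpS, hp0, hpd, hp⟩ := Finset.exists_greatest_lt hz hd0
        have hlt : (S.filter (· < p)).card < n := by
          rw [← hn]
          refine Finset.card_lt_card (Finset.ssubset_iff_of_subset ?_ |>.2 ⟨p, ?_, ?_⟩)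
          · exact Finset.monotone_filter_right S fun s _ hs => lt_trans hs hpd
          · simp [hpS, hpd]
          · simp
        have h1 := ih _ hlt p hpS hp0 rfl
        have h2 := vr_persistenceDiagram_zero_coe h0 hp0 hpd
          (vrFiltration_le_of_greatest_lt hM hp k)
        have h3 := vr_persistenceDiagram_zero_coe h0' hp0 hpd
          (vrFiltration_le_of_greatest_lt hN hp k)
        rw [h] at h2
        omega
  have hT := Finset.le_max' S 0 hz
  rw [← vr_persistenceDiagram_zero_top h0 hT
      (vrFiltration_le_of_forall_le hM (fun s hs => Finset.le_max' _ s hs) k),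
    ← vr_persistenceDiagram_zero_top h0' hT
      (vrFiltration_le_of_forall_le hN (fun s hs => Finset.le_max' _ s hs) k), h,
    key _ _ (Finset.max'_mem _ _) hT rfl]

end VietorisRips

/-! ### The distance matrix of a coloured graph -/

section EdgeDist

variable {V : Type u} {G : SimpleGraph V} {χ : Type v} {c : V → χ} {ef : Sym2 χ → ℝ}

theorem edgeDist_self (x : V) : edgeDist G c ef x x = 0 := by simp [edgeDist]

theorem edgeDist_comm (x y : V) : edgeDist G c ef x y = edgeDist G c ef y x := by
  rw [edgeDist, edgeDist, Sym2.eq_swap]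
  by_cases h : x = y <;> by_cases ha : G.Adj x y <;> simp [h, ha, ← G.adj_comm x y, eq_comm (a := y)]

theorem edgeDist_pos (h : ∀ x y, G.Adj x y → 0 < ef s(c x, c y)) (x y : V) (hxy : x ≠ y) :
    0 < edgeDist G c ef x y := by
  rw [edgeDist, if_neg hxy]
  split_ifs with ha
  · exact WithTop.coe_pos.2 (h x y ha)
  · exact WithTop.top_pos

theorem edgeDist_eq_coe_iff {d : ℝ} (hd : 0 < d) (x y : V) :
    edgeDist G c ef x y = (d : WithTop ℝ) ↔ G.Adj x y ∧ ef s(c x, c y) = d := by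
  rw [edgeDist]
  split_ifs with h ha
  · subst h
    simp only [SimpleGraph.irrefl, false_and, iff_false]
    exact fun h => hd.ne (WithTop.coe_eq_coe.1 h)
  · simp [ha]
  · simp [ha]

theorem edgeDist_adj {x y : V} (h : G.Adj x y) :
    edgeDist G c ef x y = (ef s(c x, c y) : WithTop ℝ) := by
  rw [edgeDist, if_neg h.ne, if_pos h]

theorem eq_or_adj_of_edgeDist_le {x y : V} {t : ℝ} (h : edgeDist G c ef x y ≤ (t : WithTop ℝ)) :
    x = y ∨ G.Adj x y := by
  by_contra hn
  rw [not_or] at hn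
  rw [edgeDist, if_neg hn.1, if_neg hn.2] at h
  exact absurd h (WithTop.coe_lt_top t).not_ge

theorem IsEdgeFiltration.pos_of_adj {𝒢 : Set FinGraph.{u}} {C : (G : FinGraph.{u}) → G.V → χ}
    (h : IsEdgeFiltration 𝒢 C ef) {G : FinGraph.{u}} (hG : G ∈ 𝒢) (x y : G.V)
    (hxy : G.graph.Adj x y) : 0 < ef s(C G x, C G y) :=
  h.pos _ (Set.mem_iUnion₂.2 ⟨G, hG, s(x, y), hxy, rfl⟩)

end EdgeDist

/-! ### Colour class sizes from edge counts -/

/-- Used to express degrees and round-`t` colours as one function of the stable colour, valid on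
both graphs at once. -/
theorem Function.exists_factor_pair {V W χ τ : Type*} [Nonempty τ] {c : V → χ} {c' : W → χ}
    {f : V → τ} {g : W → τ} (h₁ : ∀ x x', c x = c x' → f x = f x')
    (h₂ : ∀ y y', c' y = c' y' → g y = g y') (h₁₂ : ∀ x y, c x = c' y → f x = g y) :
    ∃ F : χ → τ, (∀ x, F (c x) = f x) ∧ ∀ y, F (c' y) = g y := by
  have h : (Sum.elim f g).FactorsThrough (Sum.elim c c') := by
    rintro (x | x) (y | y) e
    · exact h₁ x y e
    · exact h₁₂ x y e
    · exact (h₁₂ y x e.symm).symm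
    · exact h₂ x y e
  let e := fun _ : χ => Classical.arbitrary τ
  exact ⟨Function.extend (Sum.elim c c') (Sum.elim f g) e, fun x => h.extend_apply e (Sum.inl x),
    fun y => h.extend_apply e (Sum.inr y)⟩

open Classical in
-- Where `D` is nonzero it can be cancelled. At most one occurring element has `D = 0`, and its
-- multiplicity is the total cardinality minus the rest.
theorem Multiset.eq_of_count_mul_eq {χ : Type*} {A B : Multiset χ} (D : χ → ℕ)
    (hcard : A.card = B.card) (h : ∀ a, A.count a * D a = B.count a * D a)
    (hz : ∀ a ∈ A + B, ∀ b ∈ A + B, D a = 0 → D b = 0 → a = b) : A = B := by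
  have hne : ∀ a, (a ∈ A + B → D a ≠ 0) → A.count a = B.count a := by
    intro a ha
    by_cases hD : D a = 0
    · have h1 : a ∉ A + B := fun h => ha h hD
      rw [Multiset.mem_add, not_or] at h1
      rw [Multiset.count_eq_zero_of_notMem h1.1, Multiset.count_eq_zero_of_notMem h1.2]
    · exact Nat.eq_of_mul_eq_mul_right (Nat.pos_of_ne_zero hD) (h a)
  ext a
  by_cases ha : a ∈ A + B → D a ≠ 0
  · exact hne a ha
  · push Not at ha
    have hf : A.filter (fun b => ¬ a = b) = B.filter (fun b => ¬ a = b) := by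
      ext b
      rw [Multiset.count_filter, Multiset.count_filter]
      split_ifs with hb
      · rfl
      · exact hne b fun hm hD => hb (hz a ha.1 b hm ha.2 hD)
    have hA := congrArg Multiset.card (Multiset.filter_add_not (fun b => a = b) A)
    have hB := congrArg Multiset.card (Multiset.filter_add_not (fun b => a = b) B)
    rw [Multiset.card_add, hf] at hA
    rw [Multiset.card_add] at hB
    rw [Multiset.count_eq_card_filter_eq, Multiset.count_eq_card_filter_eq]
    omega

section Counting

open Classical

variable {V : Type u} [Fintype V] (G : SimpleGraph V) {χ : Type v} (c : V → χ)

/-- Double counting of the ordered edges with first node coloured `a`: by first node, and by the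
colour of the second. -/
theorem count_mul_degree_eq_sum {D : χ → ℕ} (hD : ∀ x, (Finset.univ.filter (G.Adj x)).card = D (c x))
    {t : Finset χ} (ht : ∀ x, c x ∈ t) (a : χ) :
    ((Finset.univ : Finset V).val.map c).count a * D a = ∑ b ∈ t, (Finset.univ.filter
      fun q : V × V => (G.Adj q.1 q.2 ∧ c q.1 = a) ∧ c q.2 = b).card := by
  have h1 := Finset.card_eq_sum_card_fiberwise (f := fun q : V × V => c q.2) (t := t)
    (s := Finset.univ.filter fun q : V × V => G.Adj q.1 q.2 ∧ c q.1 = a) fun q _ => ht q.2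
  simp only [Finset.filter_filter] at h1
  rw [← h1, Finset.card_eq_sum_card_fiberwise (f := Prod.fst)
    (t := Finset.univ.filter fun x => c x = a) (fun q hq => by simp_all),
    Finset.sum_const_nat (m := D a), Multiset.count_map]
  · congr 1
    change _ = Multiset.card (Multiset.filter _ _)
    simp only [eq_comm]
  · intro x hx
    have hx : c x = a := by simpa using hx
    rw [← hx, ← hD x]
    refine Finset.card_bij' (fun q _ => q.2) (fun y _ => (x, y)) ?_ ?_ ?_ ?_
    · rintro ⟨z, y⟩ h
      simp only [Finset.mem_filter, Finset.mem_univ, true_and] at h ⊢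
      exact h.2 ▸ h.1.1
    · intro y h
      simpa [hx] using h
    · rintro ⟨z, y⟩ h
      simp only [Finset.mem_filter, Finset.mem_univ, true_and] at h
      rw [h.2]
    · intro y _
      rfl

/-- The colour pairs `(a, b)` and `(b, a)` are exchanged by reversing edges, and coincide when `a =
b`. -/
theorem card_coloredEdge_eq (a b : χ) :
    (Finset.univ.filter fun q : V × V => G.Adj q.1 q.2 ∧ s(c q.1, c q.2) = s(a, b)).card =
      (if a = b then 1 else 2) * (Finset.univ.filter
        fun q : V × V => (G.Adj q.1 q.2 ∧ c q.1 = a) ∧ c q.2 = b).card := by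
  have hu : (Finset.univ.filter fun q : V × V => G.Adj q.1 q.2 ∧ s(c q.1, c q.2) = s(a, b)) =
      (Finset.univ.filter fun q : V × V => (G.Adj q.1 q.2 ∧ c q.1 = a) ∧ c q.2 = b) ∪
      (Finset.univ.filter fun q : V × V => (G.Adj q.1 q.2 ∧ c q.1 = b) ∧ c q.2 = a) := by
    ext ⟨x, y⟩
    simp only [Finset.mem_filter, Finset.mem_univ, true_and, Finset.mem_union, Sym2.eq_iff]
    tauto
  have hs : (Finset.univ.filter fun q : V × V => (G.Adj q.1 q.2 ∧ c q.1 = b) ∧ c q.2 = a).card =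
      (Finset.univ.filter fun q : V × V => (G.Adj q.1 q.2 ∧ c q.1 = a) ∧ c q.2 = b).card := by
    refine Finset.card_equiv (Equiv.prodComm V V) fun q => ?_
    simp only [Finset.mem_filter, Finset.mem_univ, true_and, Equiv.prodComm_apply, Prod.fst_swap,
      Prod.snd_swap, G.adj_comm q.1]
    tauto
  rw [hu]
  split_ifs with h
  · rw [h, Finset.union_self, one_mul]
  · rw [Finset.card_union_of_disjoint, hs, two_mul]
    rw [Finset.disjoint_left]
    rintro ⟨x, y⟩ h1 h2
    simp only [Finset.mem_filter, Finset.mem_univ, true_and] at h1 h2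
    exact h (h1.1.2.symm.trans h2.1.2)

end Counting

/-! ### Colour refinement on isolated nodes and regular graphs -/

section WeisfeilerLehman

open Classical

variable {V : Type u} [Fintype V] {G : SimpleGraph V} {W : Type u} [Fintype W] {H : SimpleGraph W}

theorem card_neighbors_eq_of_wlColor_eq {x : V} {y : W} (h : wlColor G 1 x = wlColor H 1 y) :
    (Finset.univ.filter (G.Adj x)).card = (Finset.univ.filter (H.Adj y)).card := by
  have h2 : Multiset.card (Multiset.map (wlColor G 0) (Finset.univ.filter (G.Adj x)).val) =
      Multiset.card (Multiset.map (wlColor H 0) (Finset.univ.filter (H.Adj y)).val) :=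
    congrArg (fun p : WLColor 0 × Multiset (WLColor 0) => Multiset.card p.2) h
  rwa [Multiset.card_map, Multiset.card_map] at h2

theorem wlColor_eq_of_isolated {x : V} {y : W} (hx : (Finset.univ.filter (G.Adj x)).card = 0)
    (hy : (Finset.univ.filter (H.Adj y)).card = 0) (t : ℕ) : wlColor G t x = wlColor H t y := by
  induction t with
  | zero => rfl
  | succ t ih =>
    rw [Finset.card_eq_zero] at hx hy
    refine Prod.ext ih ?_
    change Multiset.map _ (Finset.univ.filter fun z => G.Adj x z).val =
      Multiset.map _ (Finset.univ.filter fun z => H.Adj y z).val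
    rw [hx, hy]
    rfl

theorem wlColor_eq_of_regular {k : ℕ} (hG : ∀ x, (Finset.univ.filter (G.Adj x)).card = k)
    (hH : ∀ y, (Finset.univ.filter (H.Adj y)).card = k) (t : ℕ) (x : V) (y : W) :
    wlColor G t x = wlColor H t y := by
  induction t generalizing x y with
  | zero => rfl
  | succ t ih =>
    refine Prod.ext (ih x y) ?_
    change Multiset.map _ (Finset.univ.filter fun z => G.Adj x z).val =
      Multiset.map _ (Finset.univ.filter fun z => H.Adj y z).val
    -- By induction all nodes of both graphs have the colour of `y`, so the two multisets are
    -- constant and only their sizes, the degrees, matter.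
    rw [Multiset.map_congr rfl fun z _ => ih z y,
      Multiset.map_congr rfl fun z _ => (ih x z).symm.trans (ih x y), Multiset.map_const',
      Multiset.map_const']
    congr 1
    exact (hG x).trans (hH y).symm

end WeisfeilerLehman

open Classical in
theorem not_wlDistinguishes_of_regular {G H : FinGraph.{u}} {k : ℕ}
    (hG : ∀ x, (Finset.univ.filter (G.graph.Adj x)).card = k)
    (hH : ∀ y, (Finset.univ.filter (H.graph.Adj y)).card = k)
    (hcard : Fintype.card G.V = Fintype.card H.V) : ¬ WLDistinguishes G H := by
  rintro ⟨t, ht⟩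
  refine ht ?_
  rcases isEmpty_or_nonempty H.V with hE | ⟨⟨y⟩⟩
  · have hE' : IsEmpty G.V := by rwa [← Fintype.card_eq_zero_iff, hcard, Fintype.card_eq_zero_iff]
    simp [wlHistogram]
  · rw [wlHistogram, wlHistogram,
      Multiset.map_congr rfl fun z _ => wlColor_eq_of_regular hG hH t z y,
      Multiset.map_congr rfl fun z _ => wlColor_eq_of_regular hH hH t z y, Multiset.map_const',
      Multiset.map_const']
    congr 1

/-! ### The diagrams determine the WL histograms -/

open Classical in
/-- The topological edge diagram of an injective edge filtration on a stable colouring determines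
the number of (ordered) edges with given colours. -/
theorem card_edges_eq_of_TED_eq {𝒢 : Set FinGraph.{u}} {χ : Type v} {C : (G : FinGraph.{u}) → G.V → χ}
    {ef : Sym2 χ → ℝ} (hef : IsEdgeFiltration 𝒢 C ef) (hinj : Set.InjOn ef (coloredEdges 𝒢 C))
    {G H : FinGraph.{u}} (hG : G ∈ 𝒢) (hH : H ∈ 𝒢) (h : TED G (C G) ef = TED H (C H) ef) (a b : χ) :
    (Finset.univ.filter fun q : G.V × G.V =>
      (G.graph.Adj q.1 q.2 ∧ C G q.1 = a) ∧ C G q.2 = b).card =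
    (Finset.univ.filter fun q : H.V × H.V =>
      (H.graph.Adj q.1 q.2 ∧ C H q.1 = a) ∧ C H q.2 = b).card := by
  have hmem : ∀ {F : FinGraph.{u}} (_ : F ∈ 𝒢) {x y : F.V}, F.graph.Adj x y →
      s(C F x, C F y) ∈ coloredEdges 𝒢 C := fun {F} hF {x y} hxy =>
    Set.mem_iUnion₂.2 ⟨F, hF, s(x, y), hxy, rfl⟩
  suffices hs : (Finset.univ.filter fun q : G.V × G.V =>
      G.graph.Adj q.1 q.2 ∧ s(C G q.1, C G q.2) = s(a, b)).card =
      (Finset.univ.filter fun q : H.V × H.V =>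
      H.graph.Adj q.1 q.2 ∧ s(C H q.1, C H q.2) = s(a, b)).card by
    rw [card_coloredEdge_eq, card_coloredEdge_eq] at hs
    exact Nat.eq_of_mul_eq_mul_left (by split_ifs <;> norm_num) hs
  -- Positivity and injectivity of `ef` hold only on coloured edges; for any other pair of colours
  -- both counts are zero.
  by_cases hab : s(a, b) ∈ coloredEdges 𝒢 C
  · have hd := hef.pos _ hab
    have key : ∀ {F : FinGraph.{u}} (_ : F ∈ 𝒢), (Finset.univ.filter fun q : F.V × F.V =>
        F.graph.Adj q.1 q.2 ∧ s(C F q.1, C F q.2) = s(a, b)).card =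
        2 * (phVR 0 F (C F) ef (0, (ef s(a, b) : WithTop ℝ)) +
          phVR 1 F (C F) ef (ef s(a, b), ⊤)) := by
      intro F hF
      refine Eq.trans ?_ (card_pairs_eq edgeDist_self edgeDist_comm hd)
      congr 1
      ext ⟨x, y⟩
      simp only [Finset.mem_filter, Finset.mem_univ, true_and, edgeDist_eq_coe_iff hd]
      exact and_congr_right fun hxy => ⟨fun e => by rw [e], hinj (hmem hF hxy) hab⟩
    rw [key hG, key hH, show phVR 0 G (C G) ef = phVR 0 H (C H) ef from congrArg Prod.fst h,
      show phVR 1 G (C G) ef = phVR 1 H (C H) ef from congrArg Prod.snd h]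
  · rw [Finset.filter_false_of_mem, Finset.filter_false_of_mem]
    · rfl
    · rintro ⟨x, y⟩ - ⟨hxy, e⟩
      exact hab (e ▸ hmem hH hxy)
    · rintro ⟨x, y⟩ - ⟨hxy, e⟩
      exact hab (e ▸ hmem hG hxy)

theorem TED_ne_of_wlDistinguishes {𝒢 : Set FinGraph.{u}} {χ : Type v}
    {C : (G : FinGraph.{u}) → G.V → χ} {ef : Sym2 χ → ℝ} (hC : IsStableWLColoring 𝒢 C)
    (hef : IsEdgeFiltration 𝒢 C ef) (hinj : Set.InjOn ef (coloredEdges 𝒢 C))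
    {G H : FinGraph.{u}} (hG : G ∈ 𝒢) (hH : H ∈ 𝒢) (hGH : WLDistinguishes G H) :
    TED G (C G) ef ≠ TED H (C H) ef := by
  classical
  intro h
  obtain ⟨t, ht⟩ := hGH
  refine ht ?_
  suffices hmap : (Finset.univ : Finset G.V).val.map (C G) =
      (Finset.univ : Finset H.V).val.map (C H) by
    have : Nonempty (WLColor t) := by
      by_contra hn
      rw [not_nonempty_iff] at hn
      have : IsEmpty G.V := Function.isEmpty (wlColor G.graph t)
      have : IsEmpty H.V := Function.isEmpty (wlColor H.graph t)
      simp [wlHistogram] at ht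
    obtain ⟨F, hF, hF'⟩ := Function.exists_factor_pair (c := C G) (c' := C H)
      (f := wlColor G.graph t) (g := wlColor H.graph t)
      (fun x y e => (hC G hG G hG x y).1 e t) (fun x y e => (hC H hH H hH x y).1 e t)
      (fun x y e => (hC G hG H hH x y).1 e t)
    have := congrArg (Multiset.map F) hmap
    simpa only [Multiset.map_map, Function.comp_def, hF, hF', wlHistogram] using this
  have hcard : Fintype.card G.V = Fintype.card H.V :=
    card_eq_of_persistenceDiagram_eq edgeDist_self (edgeDist_pos (hef.pos_of_adj hG))
      edgeDist_self (edgeDist_pos (hef.pos_of_adj hH)) (congrArg Prod.fst h)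
  obtain ⟨D, hD, hD'⟩ := Function.exists_factor_pair (c := C G) (c' := C H)
    (f := fun x => (Finset.univ.filter (G.graph.Adj x)).card)
    (g := fun y => (Finset.univ.filter (H.graph.Adj y)).card)
    (fun x y e => card_neighbors_eq_of_wlColor_eq ((hC G hG G hG x y).1 e 1))
    (fun x y e => card_neighbors_eq_of_wlColor_eq ((hC H hH H hH x y).1 e 1))
    (fun x y e => card_neighbors_eq_of_wlColor_eq ((hC G hG H hH x y).1 e 1))
  refine Multiset.eq_of_count_mul_eq D ?_ (fun a => ?_) ?_
  · simpa using hcard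
  · have hG' := count_mul_degree_eq_sum G.graph (C G) (fun x => (hD x).symm)
      (t := Finset.univ.image (C G) ∪ Finset.univ.image (C H)) (by simp) a
    have hH' := count_mul_degree_eq_sum H.graph (C H) (fun x => (hD' x).symm)
      (t := Finset.univ.image (C G) ∪ Finset.univ.image (C H)) (by simp) a
    rw [hG', hH']
    exact Finset.sum_congr rfl fun b _ => card_edges_eq_of_TED_eq hef hinj hG hH h a b
  · intro a ha b hb ha0 hb0
    simp only [Multiset.mem_add, Multiset.mem_map, Finset.mem_val, Finset.mem_univ, true_and]
      at ha hb
    rcases ha with ⟨x, rfl⟩ | ⟨x, rfl⟩ <;> rcases hb with ⟨y, rfl⟩ | ⟨y, rfl⟩ <;>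
      simp only [hD, hD'] at ha0 hb0
    · exact (hC G hG G hG x y).2 (wlColor_eq_of_isolated ha0 hb0)
    · exact (hC G hG H hH x y).2 (wlColor_eq_of_isolated ha0 hb0)
    · exact (hC H hH G hG x y).2 (wlColor_eq_of_isolated ha0 hb0)
    · exact (hC H hH H hH x y).2 (wlColor_eq_of_isolated ha0 hb0)

/-! ### Components and the essential points in dimension zero -/

namespace PreAbstractSimplicialComplex

theorem add_self_eq_zero_of_pi {ι : Type*} (f : ι → 𝔽₂) : f + f = 0 :=
  funext fun i => CharTwo.add_self_eq_zero (R := ZMod 2) (f i)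

variable {V : Type u} [Fintype V]

/-- Along a walk the intermediate vertices cancel modulo 2, so each vertex is homologous to `x₀` and
the boundaries have codimension at most one in the 0-cycles. -/
theorem card_le_finrank_boundaries_add_one {L : PreAbstractSimplicialComplex V}
    (hV : ∀ x, {x} ∈ L.faces) {G : SimpleGraph V} (hG : G.Preconnected)
    (hL : ∀ x y, G.Adj x y → ∃ s ∈ L.faces, ∀ z, z ∈ s ↔ z = x ∨ z = y) :
    Fintype.card V ≤ Module.finrank 𝔽₂ (L.boundaries 0) + 1 := by
  classical
  rcases isEmpty_or_nonempty V with hE | ⟨⟨x₀⟩⟩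
  · simp
  have hedge : ∀ x y, G.Adj x y →
      (Pi.single {x} 1 + Pi.single {y} 1 : Finset V → 𝔽₂) ∈ L.boundaries 0 := by
    intro x y hxy
    obtain ⟨s, hs, hsxy⟩ := hL x y hxy
    obtain rfl : s = {x, y} := by ext z; simp [hsxy]
    refine ⟨Pi.single {x, y} 1, fun s h => ?_, ?_⟩
    · refine Pi.single_eq_of_ne (fun e => h ?_) _
      rw [e]
      exact ⟨hs, Finset.card_pair hxy.ne⟩
    · convert boundary_single_pair hxy.ne using 3
  have hreach : ∀ x, (Pi.single {x} 1 + Pi.single {x₀} 1 : Finset V → 𝔽₂) ∈ L.boundaries 0 := by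
    intro x
    obtain ⟨w⟩ := hG x x₀
    induction w with
    | nil => rw [add_self_eq_zero_of_pi]; exact zero_mem _
    | cons h _ ih =>
      have h3 := add_mem (hedge _ _ h) ih
      rwa [add_assoc, ← add_assoc _ _ (Pi.single _ 1), add_self_eq_zero_of_pi, zero_add] at h3
  have hcycles : L.cycles 0 ≤ L.boundaries 0 ⊔ Submodule.span 𝔽₂ {Pi.single {x₀} 1} := by
    rw [cycles_zero]
    intro c hc
    rw [← Finset.univ_sum_single c]
    refine sum_mem fun s _ => ?_
    by_cases hs : s.card = 1
    · obtain ⟨x, rfl⟩ := Finset.card_eq_one.1 hs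
      have e : Pi.single {x} (c {x}) = c {x} • ((Pi.single {x} 1 + Pi.single {x₀} 1) -
          Pi.single {x₀} 1 : Finset V → 𝔽₂) := by
        rw [add_sub_cancel_right, ← Pi.single_smul, smul_eq_mul, mul_one]
      rw [e]
      exact Submodule.smul_mem _ _ (sub_mem (Submodule.mem_sup_left (hreach x))
        (Submodule.mem_sup_right (Submodule.mem_span_singleton_self _)))
    · rw [hc s fun h => hs h.2, Pi.single_zero]
      exact zero_mem _
  rw [← finrank_cycles_zero hV]
  refine (Submodule.finrank_mono hcycles).trans
    ((Submodule.finrank_add_le_finrank_add_finrank _ _).trans ?_)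
  exact Nat.add_le_add_left ((finrank_span_le_card _).trans (by simp)) _

/-- Summing coefficients over the fibres of `π` maps the 0-cycles onto `ι → 𝔽₂`. It kills
boundaries, since both ends of an edge have the same label; rank-nullity gives the bound. -/
theorem finrank_boundaries_add_card_le {L : PreAbstractSimplicialComplex V}
    (hV : ∀ x, {x} ∈ L.faces) {ι : Type*} [Fintype ι] {π : V → ι} (hπ : Function.Surjective π)
    (hL : ∀ s ∈ L.faces, ∀ x ∈ s, ∀ y ∈ s, π x = π y) :
    Module.finrank 𝔽₂ (L.boundaries 0) + Fintype.card ι ≤ Fintype.card V := by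
  classical
  let Φ : (Finset V → 𝔽₂) →ₗ[𝔽₂] (ι → 𝔽₂) :=
    { toFun := fun u i => ∑ x with π x = i, u {x}
      map_add' := fun u v => by ext i; simp [Finset.sum_add_distrib]
      map_smul' := fun r u => by ext i; simp [Finset.mul_sum] }
  have hsingle : ∀ x, Φ (Pi.single {x} 1) = Pi.single (π x) 1 := by
    intro x
    ext i
    change ∑ z with π z = i, (Pi.single {x} 1 : Finset V → 𝔽₂) {z} = _
    simp [Pi.single_apply, eq_comm]
  have hB : L.boundaries 0 ≤ LinearMap.ker Φ := by
    rintro _ ⟨c, hc, rfl⟩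
    rw [LinearMap.mem_ker, ← Finset.univ_sum_single c, map_sum, map_sum]
    refine Finset.sum_eq_zero fun s _ => ?_
    by_cases hs : s ∈ L.faces ∧ s.card = 2
    · obtain ⟨x, y, hxy, rfl⟩ := Finset.card_eq_two.1 hs.2
      have hb : boundary V (Pi.single {x, y} 1) = Pi.single {x} 1 + Pi.single {y} 1 := by
        convert boundary_single_pair hxy using 3
      rw [← mul_one (c {x, y}), ← smul_eq_mul, Pi.single_smul, map_smul, hb, map_smul, map_add,
        hsingle, hsingle, hL _ hs.1 x (by simp) y (by simp), add_self_eq_zero_of_pi, smul_zero]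
    · rw [hc s hs, Pi.single_zero, map_zero, map_zero]
  have hrange : LinearMap.range (Φ.domRestrict (L.cycles 0)) = ⊤ := by
    refine eq_top_iff.2 fun f _ => ?_
    rw [← Finset.univ_sum_single f]
    refine sum_mem fun i _ => ?_
    obtain ⟨x, rfl⟩ := hπ i
    rw [← mul_one (f (π x)), ← smul_eq_mul, Pi.single_smul]
    refine Submodule.smul_mem _ _ ⟨⟨Pi.single {x} 1, ?_⟩, hsingle x⟩
    rw [cycles_zero]
    refine fun s hs => Pi.single_eq_of_ne (fun e => hs ?_) _
    rw [e]
    exact ⟨hV x, by simp⟩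
  have h := LinearMap.finrank_range_add_finrank_ker (Φ.domRestrict (L.cycles 0))
  rw [hrange, finrank_top, Module.finrank_fintype_fun_eq_card, finrank_cycles_zero hV,
    LinearMap.ker_domRestrict] at h
  rw [← h, add_comm, ← Submodule.finrank_submoduleOf (boundaries_zero_le hV)]
  exact Nat.add_le_add_left (Submodule.finrank_mono (Submodule.comap_mono hB)) _

end PreAbstractSimplicialComplex

theorem exists_last_scale {V : Type u} [Fintype V] (M : V → V → WithTop ℝ) :
    ∃ T : ℝ, 0 ≤ T ∧ (∀ x y (r : ℝ), M x y = r → r ≤ T) ∧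
      ∀ k s, vrFiltration M k s ≤ vrFiltration M k T := by
  obtain ⟨S, hS⟩ := exists_finset_values M
  obtain ⟨T, hT⟩ := (insert 0 S).bddAbove
  have hle : ∀ s ∈ S, s ≤ T := fun s hs => hT (by simp [hs])
  exact ⟨T, hT (by simp), fun x y r h => hle r (hS x y r h),
    fun k s => vrFiltration_le_of_forall_le hS hle k s⟩

theorem phVR_zero_top_le_one {G : FinGraph.{u}} (hG : G.graph.Preconnected) {χ : Type v}
    (c : G.V → χ) (ef : Sym2 χ → ℝ) : phVR 0 G c ef (0, ⊤) ≤ 1 := by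
  classical
  obtain ⟨T, hT, hle, hKT⟩ := exists_last_scale (edgeDist G.graph c ef)
  have h1 := vr_persistenceDiagram_zero_top edgeDist_self hT (hKT 1)
  have h2 := PreAbstractSimplicialComplex.card_le_finrank_boundaries_add_one
    (singleton_mem_vrFiltration (M := edgeDist G.graph c ef) (k := 1) edgeDist_self hT) hG
    fun x y hxy => ⟨{x, y}, ?_, by simp⟩
  · rw [phVR]
    omega
  · have hd := edgeDist_adj (c := c) (ef := ef) hxy
    have hb : edgeDist G.graph c ef x y ≤ (T : WithTop ℝ) :=
      hd ▸ WithTop.coe_le_coe.2 (hle x y _ hd)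
    refine ⟨⟨⟨x, by simp⟩, fun z hz w hw => ?_⟩, Finset.card_le_two⟩
    have h0 : (0 : WithTop ℝ) ≤ T := WithTop.coe_le_coe.2 hT
    simp only [Finset.mem_insert, Finset.mem_singleton] at hz hw
    rcases hz with rfl | rfl <;> rcases hw with rfl | rfl
    · rwa [edgeDist_self]
    · exact hb
    · rwa [edgeDist_comm]
    · rwa [edgeDist_self]

theorem card_le_phVR_zero_top {G : FinGraph.{u}} {ι : Type*} [Fintype ι] {π : G.V → ι}
    (hπ : Function.Surjective π) (hG : ∀ x y, G.graph.Adj x y → π x = π y) {χ : Type v}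
    (c : G.V → χ) (ef : Sym2 χ → ℝ) : Fintype.card ι ≤ phVR 0 G c ef (0, ⊤) := by
  obtain ⟨T, hT, -, hKT⟩ := exists_last_scale (edgeDist G.graph c ef)
  have h1 := vr_persistenceDiagram_zero_top edgeDist_self hT (hKT 1)
  have h2 := PreAbstractSimplicialComplex.finrank_boundaries_add_card_le
    (singleton_mem_vrFiltration (M := edgeDist G.graph c ef) (k := 1) edgeDist_self hT) hπ
    fun s hs x hx y hy => (eq_or_adj_of_edgeDist_le (hs.1.2 x hx y hy)).elim (congrArg π) (hG x y)
  rw [phVR]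
  omega

/-! ### The hexagon and the two triangles -/

/-- The cycle on six nodes. -/
def hexagon : FinGraph.{u} where
  V := ULift (Fin 6)
  graph := (SimpleGraph.cycleGraph 6).comap ULift.down

/-- The disjoint union of two triangles. -/
def twoTriangles : FinGraph.{u} where
  V := ULift (Fin 2 × Fin 3)
  graph :=
    { Adj := fun x y => x.down.1 = y.down.1 ∧ x.down.2 ≠ y.down.2
      symm := ⟨fun _ _ h => ⟨h.1.symm, h.2.symm⟩⟩
      loopless := ⟨fun _ h => h.2 rfl⟩ }

theorem hexagon_preconnected : hexagon.{u}.graph.Preconnected := by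
  let e : hexagon.{u}.graph ≃g SimpleGraph.cycleGraph 6 := ⟨Equiv.ulift, Iff.rfl⟩
  exact e.preconnected_iff.2 SimpleGraph.cycleGraph_preconnected

open Classical in
theorem card_neighbors_hexagon (x : hexagon.{u}.V) :
    (Finset.univ.filter (hexagon.{u}.graph.Adj x)).card = 2 := by
  have h : ∀ v : Fin 6, (Finset.univ.filter fun w => v - w = 1 ∨ w - v = 1).card = 2 := by decide
  rw [← h x.down]
  refine Finset.card_equiv Equiv.ulift fun y => ?_
  simp only [Finset.mem_filter, Finset.mem_univ, true_and]
  exact SimpleGraph.cycleGraph_adj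

open Classical in
theorem card_neighbors_twoTriangles (x : twoTriangles.{u}.V) :
    (Finset.univ.filter (twoTriangles.{u}.graph.Adj x)).card = 2 := by
  have h : ∀ v : Fin 2 × Fin 3,
      (Finset.univ.filter fun w : Fin 2 × Fin 3 => v.1 = w.1 ∧ v.2 ≠ w.2).card = 2 := by decide
  rw [← h x.down]
  refine Finset.card_equiv Equiv.ulift fun y => ?_
  simp only [Finset.mem_filter, Finset.mem_univ, true_and]
  rfl

theorem twoTriangles_not_preconnected : ¬ twoTriangles.{u}.graph.Preconnected := by
  intro h
  have hr : ∀ x y : twoTriangles.{u}.V, twoTriangles.{u}.graph.Reachable x y →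
      x.down.1 = y.down.1 := by
    rintro x y ⟨w⟩
    induction w with
    | nil => rfl
    | cons h _ ih => exact h.1.trans ih
  exact absurd (hr ⟨(0, 0)⟩ ⟨(1, 0)⟩ (h _ _)) (by decide)

theorem theorem4p2 :
    (∀ (𝒢 : Set FinGraph.{u}) (χ : Type v) (C : (G : FinGraph.{u}) → G.V → χ) (ef : Sym2 χ → ℝ),
      IsStableWLColoring 𝒢 C → IsEdgeFiltration 𝒢 C ef → Set.InjOn ef (coloredEdges 𝒢 C) →
      ∀ G ∈ 𝒢, ∀ H ∈ 𝒢, WLDistinguishes G H → TED G (C G) ef ≠ TED H (C H) ef) ∧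
    (∃ G H : FinGraph.{u}, ¬ Nonempty (G.graph ≃g H.graph) ∧ ¬ WLDistinguishes G H ∧
      ∀ (𝒢 : Set FinGraph.{u}) (χ : Type v) (C : (G : FinGraph.{u}) → G.V → χ) (ef : Sym2 χ → ℝ),
        IsStableWLColoring 𝒢 C → IsEdgeFiltration 𝒢 C ef → Set.InjOn ef (coloredEdges 𝒢 C) →
        G ∈ 𝒢 → H ∈ 𝒢 → TED G (C G) ef ≠ TED H (C H) ef) := by
  refine ⟨fun 𝒢 χ C ef hC hef hinj G hG H hH => TED_ne_of_wlDistinguishes hC hef hinj hG hH,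
    hexagon, twoTriangles, ?_, ?_, ?_⟩
  · rintro ⟨e⟩
    exact twoTriangles_not_preconnected (e.preconnected_iff.1 hexagon_preconnected)
  · refine not_wlDistinguishes_of_regular card_neighbors_hexagon card_neighbors_twoTriangles ?_
    change Fintype.card (ULift (Fin 6)) = Fintype.card (ULift (Fin 2 × Fin 3))
    simp
  · intro 𝒢 χ C ef _ _ _ _ _ h
    have h1 := phVR_zero_top_le_one hexagon_preconnected (C hexagon) ef
    -- Labelling each node by its triangle gives multiplicity at least 2 at `(0, ∞)`, against at
    -- most 1 for the connected hexagon.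
    have h2 := card_le_phVR_zero_top (G := twoTriangles) (π := fun x => x.down.1)
      (fun i => ⟨⟨(i, 0)⟩, rfl⟩) (fun _ _ h => h.1) (C twoTriangles) ef
    rw [show phVR 0 hexagon (C hexagon) ef = phVR 0 twoTriangles (C twoTriangles) ef from
      congrArg Prod.fst h] at h1
    rw [Fintype.card_fin] at h2
    omega
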